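/- **Setting.** Let $Z$ be a random data vector with law $P$, $X$ a measurable function of $Z$ (e.g. a sub-vector), $\Theta\subseteq\mathbb R^d$ with $\theta_0\in\Theta$, $\mathcal H$ a set of measurable functions $h$ of $X$ with values in $\mathbb R^\ell$ with $h_0\in\mathcal H$, and $m(z,\theta,\gamma)\in\mathbb R^d$ a measurable moment function of $z$, $\theta\in\mathbb R^d$, $\gamma\in\mathbb R^\ell$, with $\mathbb E[m(Z,\theta_0,h_0(X))\mid X]=0$ a.s. Let $Z_1,Z_2,\dots$ be i.i.d. copies of $Z$ (with corresponding $X_t$); at sample size $n$ the data are $Z_1,\dots,Z_{2n}$. *Sample splitting:* $\hat h\in\mathcal H$ is a measurable function of $Z_{n+1},\dots,Z_{2n}$, and $\hat\theta^{SS}\in\Theta$ solves $\hat M(\theta):=\frac1n\sum_{t=1}^n m(Z_t,\theta,\hat h(X_t))=0$. *$K$-fold cross-fitting* ($K\ge1$ fixed, along those $n$ with $K\mid 2n$): $\{1,\dots,2n\}$ is partitioned into $I_1,\dots,I_K$ of size $2n/K$, $\hat h_k\in\mathcal H$ is a measurable function of $(Z_t)_{t\notin I_k}$, and $\hat\theta^{CF}\in\Theta$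 solves $\hat M(\theta):=\frac1{2n}\sum_{k=1}^K\sum_{t\in I_k}m(Z_t,\theta,\hat h_k(X_t))=0$. **Assumption 1.** Let $D^\alpha m=\nabla_{\gamma_1}^{\alpha_1}\cdots\nabla_{\gamma_\ell}^{\alpha_\ell}m$ for $\alpha\in\mathbb N^\ell$. For a non-empty finite $S\subseteq\mathbb N^\ell$ and $k=\max_{\alpha\in S}\|\alpha\|_1$: 1. $\mathbb E[D^\alpha m(Z,\theta_0,h_0(X))\mid X]=0$ a.s. for all $\alpha\in S$. 2. $\mathbb E[m(Z,\theta,h_0(X))]\ne0$ for all $\theta\in\Theta$, $\theta\neq\theta_0$. 3. $\mathbb E[\nabla_\theta m(Z,\theta_0,h_0(X))]$ is invertible. 4. For each $z$, $m(z,\cdot,\cdot)$ is $k$ times continuously differentiable in $(\theta,\gamma)$. 5. $\mathbb E[\prod_i|\hat h_i(X)-h_{0,i}(X)|^{4\alpha_i}\mid\hat h]\to0$ in probability for all nonzero $\alpha\in S$, where $X$ is independent of $\hat h$. 6. $n^{1/2}\big(\mathbb E[\prod_i|\hat h_i(X)-h_{0,i}(X)|^{2\alpha_i}\mid\hat h]\big)^{1/2}\to0$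 in probability for all nonzero $\alpha\notin S$ with $\|\alpha\|_1\le k+1$. 7. There is $r>0$ such that, with $B_{\theta_0}=\{\theta\in\Theta:\|\theta-\theta_0\|_2\le r\}$ and $B_{h_0}=\{h\in\mathcal H:\mathbb E[\prod_i|h_i(X)-h_{0,i}(X)|^{2\alpha_i}]\le r\ \text{ for all } 1\le\|\alpha\|_1\le k+1\}$, the derivatives below exist and (a) $\mathbb E[\sup_{\theta\in B_{\theta_0}}\|\nabla_\theta m(Z,\theta,h_0(X))\|_F]<\infty$; (b) $\sup_{h\in B_{h_0}}\mathbb E[\sup_{\theta\in B_{\theta_0}}\|\nabla_\gamma\nabla_\theta m(Z,\theta,h(X))\|^2]<\infty$; (c) $\max_{\|\alpha\|_1\le k+1}\sup_{h\in B_{h_0}}\mathbb E[\|D^\alpha m(Z,\theta_0,h(X))\|^4]<\infty$; (d) $\mathbb E[\sup_{\theta\in A,h\in B_{h_0}}\|m(Z,\theta,h(X))\|_2]<\infty$ for every compact $A\subseteq\Theta$; (e) $\sup_{\theta\in A,h\in B_{h_0}}\mathbb E[\|\nabla_\gamma m(Z,\theta,h(X))\|^2]<\infty$ for every compact $A\subseteq\Theta$.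 For cross-fitting, items 5 and 6 are required of each $\hat h_k$ in place of $\hat h$. **Theorem (Consistency).** Suppose that Assumption 1 holds for an estimator ($\hat\theta^{SS}$ or $\hat\theta^{CF}$), and that either $\Theta$ is compact, or $\Theta$ is convex, $\theta_0$ is in the interior of $\Theta$ and, with probability tending to $1$, the empirical moment map $\theta\mapsto\hat M(\theta)$ of that estimator is on $\Theta$ the gradient of a convex function. Then that estimator is consistent: $\hat\theta^{SS}\to\theta_0$ in probability, respectively $\hat\theta^{CF}\to\theta_0$ in probability. -/

import Mathlib

open MeasureTheory ProbabilityTheory Filter Topology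
open scoped ENNReal NNReal

namespace OrthogonalML

noncomputable section

/-- The Euclidean space `ℝⁿ`. -/
abbrev Vec (n : ℕ) : Type := EuclideanSpace ℝ (Fin n)

/-- Outer expectation of a nonnegative, possibly non-measurable function (used for suprema over
uncountable families): the infimum of the integrals of its measurable majorants. It is the usual
expectation on measurable functions. -/
def outerExpect {α : Type*} [MeasurableSpace α] (P : Measure α) (f : α → ℝ≥0∞) : ℝ≥0∞ :=
  ⨅ g : α → ℝ≥0∞, ⨅ _ : Measurable g, ⨅ _ : ∀ a, f a ≤ g a, ∫⁻ a, g a ∂P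

/-- Convergence to zero in probability, along the filter `l`, of nonnegative extended-real
random quantities. -/
def ToProbZero {Ω : Type*} [MeasurableSpace Ω] (μ : Measure Ω) (l : Filter ℕ)
    (Y : ℕ → Ω → ℝ≥0∞) : Prop :=
  ∀ ε : ℝ≥0∞, 0 < ε → Tendsto (fun n => μ {ω | ε ≤ Y n ω}) l (𝓝 0)

/-! ### Differentials -/

/-- The partial derivative in the `i`-th coordinate. -/
def partialDeriv {d l : ℕ} (i : Fin l) (f : Vec l → Vec d) : Vec l → Vec d :=
  fun γ => lineDeriv ℝ f γ (EuclideanSpace.single i 1)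

/-- `D^α f = ∇₁^{α₁} ∇₂^{α₂} ⋯ ∇ₗ^{αₗ} f`. -/
def multiDeriv {d l : ℕ} (α : Fin l → ℕ) (f : Vec l → Vec d) : Vec l → Vec d :=
  (List.finRange l).foldr (fun i g => (partialDeriv i)^[α i] g) f

/-- The length `‖α‖₁` of a multi-index. -/
def absIndex {l : ℕ} (α : Fin l → ℕ) : ℕ := ∑ i, α i

/-- `k = max_{α ∈ S} ‖α‖₁`. -/
def maxOrder {l : ℕ} (S : Finset (Fin l → ℕ)) : ℕ := S.sup absIndex

/-- Jacobian matrix: the `(i, j)` entry is `∂ f_i / ∂ θ_j`. -/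
def jacobian {d : ℕ} (f : Vec d → Vec d) (θ : Vec d) : Matrix (Fin d) (Fin d) ℝ :=
  Matrix.of fun i j => (fderiv ℝ f θ (EuclideanSpace.single j 1)) i

/-- Frobenius norm of a matrix. -/
def frobeniusNorm {d : ℕ} (A : Matrix (Fin d) (Fin d) ℝ) : ℝ := √(∑ i, ∑ j, A i j ^ 2)

/-! ### The moment model -/

/-- The estimation problem: the law `P` of the data `Z`, the covariates `X` as a function of the
data, the parameter set `Θ`, the class `H` of nuisance functions, the moments `m z θ γ`, and the
true values `θ₀`, `h₀`, which satisfy `E[m(Z, θ₀, h₀(X)) | X] = 0` almost surely. -/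
structure Model (𝒵 𝒳 : Type*) [MeasurableSpace 𝒵] [MeasurableSpace 𝒳] (d l : ℕ) where
  P : Measure 𝒵
  isProb : IsProbabilityMeasure P
  X : 𝒵 → 𝒳
  measurable_X : Measurable X
  Θ : Set (Vec d)
  H : Set (𝒳 → Vec l)
  measurable_H : ∀ h ∈ H, Measurable h
  m : 𝒵 → Vec d → Vec l → Vec d
  measurable_m : Measurable fun q : 𝒵 × Vec d × Vec l => m q.1 q.2.1 q.2.2
  θ₀ : Vec d
  θ₀_mem : θ₀ ∈ Θ
  h₀ : 𝒳 → Vec l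
  h₀_mem : h₀ ∈ H
  integrable_moment : Integrable (fun z => m z θ₀ (h₀ (X z))) P
  moment_eq_zero :
    P[fun z => m z θ₀ (h₀ (X z)) | MeasurableSpace.comap X inferInstance] =ᵐ[P] 0

namespace Model

variable {𝒵 𝒳 : Type*} [MeasurableSpace 𝒵] [MeasurableSpace 𝒳] {d l : ℕ}

/-- `E[∏ᵢ |hᵢ(X) - h₀ᵢ(X)|^{c αᵢ}]`. -/
def nuisanceError (M : Model 𝒵 𝒳 d l) (c : ℕ) (α : Fin l → ℕ) (h : 𝒳 → Vec l) : ℝ≥0∞ :=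
  ∫⁻ z, ∏ i, ‖h (M.X z) i - M.h₀ (M.X z) i‖ₑ ^ (c * α i) ∂M.P

/-- `{θ ∈ Θ : ‖θ - θ₀‖₂ ≤ r}`. -/
def thetaBall (M : Model 𝒵 𝒳 d l) (r : ℝ) : Set (Vec d) := {θ ∈ M.Θ | ‖θ - M.θ₀‖ ≤ r}

/-- The functions `h ∈ H` with `E[∏ᵢ |hᵢ(X) - h₀ᵢ(X)|^{2αᵢ}] ≤ r` for all multi-indices `α` with
`1 ≤ ‖α‖₁ ≤ k + 1`. (For `α = 0` the expectation is the constant `1`.) -/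
def nuisanceBall (M : Model 𝒵 𝒳 d l) (k : ℕ) (r : ℝ) : Set (𝒳 → Vec l) :=
  {h ∈ M.H | ∀ α : Fin l → ℕ, α ≠ 0 → absIndex α ≤ k + 1 →
    M.nuisanceError 2 α h ≤ ENNReal.ofReal r}

/-- `S`-orthogonality: `E[D^α m(Z, θ₀, h₀(X)) | X] = 0` almost surely, for all `α ∈ S`. -/
def SOrthogonal (M : Model 𝒵 𝒳 d l) (S : Finset (Fin l → ℕ)) : Prop :=
  ∀ α ∈ S, Integrable (fun z => multiDeriv α (M.m z M.θ₀) (M.h₀ (M.X z))) M.P ∧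
    M.P[fun z => multiDeriv α (M.m z M.θ₀) (M.h₀ (M.X z)) |
      MeasurableSpace.comap M.X inferInstance] =ᵐ[M.P] 0

/-- Regularity of the moments with radius `r`. Each item about derivatives comes with the existence
of the derivatives that it mentions. -/
structure Regularity (M : Model 𝒵 𝒳 d l) (k : ℕ) (r : ℝ) : Prop where
  theta_exists : ∀ z, ∀ θ ∈ M.thetaBall r,
    DifferentiableAt ℝ (fun θ' => M.m z θ' (M.h₀ (M.X z))) θ
  theta_dominated :
    outerExpect M.P (fun z => ⨆ θ ∈ M.thetaBall r,
      ENNReal.ofReal (frobeniusNorm (jacobian (fun θ' => M.m z θ' (M.h₀ (M.X z))) θ))) < ∞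
  gamma_theta_exists : ∀ z, ∀ θ ∈ M.thetaBall r, ∀ γ : Vec l,
    DifferentiableAt ℝ (fun θ' => M.m z θ' γ) θ ∧
      DifferentiableAt ℝ (fun γ' => fderiv ℝ (fun θ' => M.m z θ' γ') θ) γ
  gamma_theta_bounded :
    (⨆ h ∈ M.nuisanceBall k r, outerExpect M.P (fun z => ⨆ θ ∈ M.thetaBall r,
      ‖fderiv ℝ (fun γ' => fderiv ℝ (fun θ' => M.m z θ' γ') θ) (h (M.X z))‖ₑ ^ 2)) < ∞
  multi_exists : ∀ z, ∀ α : Fin l → ℕ, absIndex α ≤ k → ∀ i : Fin l, ∀ γ : Vec l,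
    LineDifferentiableAt ℝ (multiDeriv α (M.m z M.θ₀)) γ (EuclideanSpace.single i 1)
  multi_bounded : ∃ lam : ℝ≥0, ∀ α : Fin l → ℕ, absIndex α ≤ k + 1 → ∀ h ∈ M.nuisanceBall k r,
    ∫⁻ z, ‖multiDeriv α (M.m z M.θ₀) (h (M.X z))‖ₑ ^ 4 ∂M.P ≤ lam
  moment_dominated : ∀ A ⊆ M.Θ, IsCompact A →
    outerExpect M.P (fun z => ⨆ θ ∈ A, ⨆ h ∈ M.nuisanceBall k r, ‖M.m z θ (h (M.X z))‖ₑ) < ∞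
  gamma_exists : ∀ z, ∀ θ ∈ M.Θ, ∀ γ : Vec l, DifferentiableAt ℝ (fun γ' => M.m z θ γ') γ
  gamma_bounded : ∀ A ⊆ M.Θ, IsCompact A →
    (⨆ θ ∈ A, ⨆ h ∈ M.nuisanceBall k r,
      ∫⁻ z, ‖fderiv ℝ (fun γ' => M.m z θ γ') (h (M.X z))‖ₑ ^ 2 ∂M.P) < ∞

/-- The assumptions on the moments: orthogonality, identifiability, non-degeneracy, smoothness
and regularity, with `k = max_{α ∈ S} ‖α‖₁`. -/
structure MomentAssumptions (M : Model 𝒵 𝒳 d l) (S : Finset (Fin l → ℕ)) : Prop where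
  nonempty : S.Nonempty
  orthogonal : M.SOrthogonal S
  identifiable : ∀ θ ∈ M.Θ, θ ≠ M.θ₀ → ∫ z, M.m z θ (M.h₀ (M.X z)) ∂M.P ≠ 0
  nondegenerate :
    IsUnit (Matrix.of fun i j =>
      ∫ z, jacobian (fun θ' => M.m z θ' (M.h₀ (M.X z))) M.θ₀ i j ∂M.P :
        Matrix (Fin d) (Fin d) ℝ)
  smooth : ∀ z, ContDiff ℝ (maxOrder S : ℕ) (fun q : Vec d × Vec l => M.m z q.1 q.2)
  regular : ∃ r : ℝ, 0 < r ∧ M.Regularity (maxOrder S) r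

/-- Consistency and rate of the first stage. Here `hhat n ω` is the estimate of `h₀` at sample
size `n`; since it is fitted on data independent of a fresh draw of `(Z, X)`, conditional
expectations given `hhat` are integrals over that fresh draw alone. Both conditions concern
nonzero multi-indices `α`: for `α = 0` the expectation is the constant `1`. -/
structure FirstStageAssumptions (M : Model 𝒵 𝒳 d l) (S : Finset (Fin l → ℕ))
    {Ω : Type*} [MeasurableSpace Ω] (μ : Measure Ω) (L : Filter ℕ)
    (hhat : ℕ → Ω → 𝒳 → Vec l) : Prop where
  consistency : ∀ α ∈ S, α ≠ 0 → ToProbZero μ L (fun n ω => M.nuisanceError 4 α (hhat n ω))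
  rate : ∀ α : Fin l → ℕ, α ≠ 0 → absIndex α ≤ maxOrder S + 1 → α ∉ S →
    ToProbZero μ L (fun n ω =>
      (n : ℝ≥0∞) ^ (1 / 2 : ℝ) * M.nuisanceError 2 α (hhat n ω) ^ (1 / 2 : ℝ))

/-- `Z 0, Z 1, …` are independent replicates of the data vector. -/
structure IsSample (M : Model 𝒵 𝒳 d l) {Ω : Type*} [MeasurableSpace Ω] (μ : Measure Ω)
    (Z : ℕ → Ω → 𝒵) : Prop where
  measurable : ∀ t, Measurable (Z t)
  indep : iIndepFun Z μ
  law : ∀ t, μ.map (Z t) = M.P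

/-- A first-stage procedure fitted on data indexed by `ι`: it maps every data set to an element of
`H`, measurably in the data and the covariate. -/
structure IsProcedure (M : Model 𝒵 𝒳 d l) {ι : Type*} (g : (ι → 𝒵) → 𝒳 → Vec l) : Prop where
  mem : ∀ w, g w ∈ M.H
  measurable : Measurable fun q : (ι → 𝒵) × 𝒳 => g q.1 q.2

/-- `F` is, on `Θ`, the gradient of a convex function. -/
def IsConvexGradient (Θ : Set (Vec d)) (F : Vec d → Vec d) : Prop :=
  ∃ φ : Vec d → ℝ, ConvexOn ℝ Θ φ ∧ ∀ θ ∈ Θ, HasGradientWithinAt φ (F θ) Θ θ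

/-- The compactness conditions or the convexity conditions, for the (random) empirical moment maps
`F n ω : θ ↦ F n ω θ`. -/
def CompactOrConvex (M : Model 𝒵 𝒳 d l) {Ω : Type*} [MeasurableSpace Ω] (μ : Measure Ω)
    (L : Filter ℕ) (F : ℕ → Ω → Vec d → Vec d) : Prop :=
  IsCompact M.Θ ∨
    (Convex ℝ M.Θ ∧ M.θ₀ ∈ interior M.Θ ∧
      Tendsto (fun n => μ {ω | ¬ IsConvexGradient M.Θ (F n ω)}) L (𝓝 0))

/-! ### Sample splitting -/

/-- The first-stage estimate fitted on the second half `Z n, …, Z (2n - 1)` of the sample. -/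
def ssNuisance {Ω : Type*} (Z : ℕ → Ω → 𝒵) (g : ∀ n : ℕ, (Fin n → 𝒵) → 𝒳 → Vec l)
    (n : ℕ) (ω : Ω) : 𝒳 → Vec l :=
  g n (fun s => Z (n + s) ω)

/-- The empirical moment map `θ ↦ (1/n) ∑ m(Z_t, θ, hhat(X_t))` over the first half
`Z 0, …, Z (n - 1)` of the sample. -/
def ssMoment (M : Model 𝒵 𝒳 d l) {Ω : Type*} (Z : ℕ → Ω → 𝒵)
    (g : ∀ n : ℕ, (Fin n → 𝒵) → 𝒳 → Vec l) (n : ℕ) (ω : Ω) (θ : Vec d) : Vec d :=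
  (1 / (n : ℝ)) • ∑ t : Fin n, M.m (Z t ω) θ (ssNuisance Z g n ω (M.X (Z t ω)))

/-! ### Cross-fitting -/

/-- The sample sizes `n` for which `K` divides `2n`, tending to infinity. -/
def cfFilter (K : ℕ) : Filter ℕ := atTop ⊓ 𝓟 {n | K ∣ 2 * n}

/-- `fold n` splits the `2n` indices into `K` folds of cardinality `2n / K` whenever `K ∣ 2n`. -/
def IsFolding {K : ℕ} (fold : ∀ n : ℕ, Fin (2 * n) → Fin K) : Prop :=
  ∀ n : ℕ, K ∣ 2 * n → ∀ k : Fin K, (Finset.univ.filter fun t => fold n t = k).card = 2 * n / K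

/-- The first-stage estimate for fold `k`, fitted on the data outside fold `k`. -/
def cfNuisance {Ω : Type*} {K : ℕ} (Z : ℕ → Ω → 𝒵) (fold : ∀ n : ℕ, Fin (2 * n) → Fin K)
    (g : ∀ (n : ℕ) (k : Fin K), ({t : Fin (2 * n) // fold n t ≠ k} → 𝒵) → 𝒳 → Vec l)
    (k : Fin K) (n : ℕ) (ω : Ω) : 𝒳 → Vec l :=
  g n k (fun s => Z s.1 ω)

/-- The empirical moment map `θ ↦ (1/(2n)) ∑ₖ ∑_{t ∈ Iₖ} m(Z_t, θ, hhatₖ(X_t))`. -/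
def cfMoment (M : Model 𝒵 𝒳 d l) {Ω : Type*} {K : ℕ} (Z : ℕ → Ω → 𝒵)
    (fold : ∀ n : ℕ, Fin (2 * n) → Fin K)
    (g : ∀ (n : ℕ) (k : Fin K), ({t : Fin (2 * n) // fold n t ≠ k} → 𝒵) → 𝒳 → Vec l)
    (n : ℕ) (ω : Ω) (θ : Vec d) : Vec d :=
  (1 / (2 * (n : ℝ))) • ∑ k : Fin K, ∑ t : Fin (2 * n) with fold n t = k,
    M.m (Z t ω) θ (cfNuisance Z fold g k n ω (M.X (Z t ω)))

end Model

end

end OrthogonalML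

open OrthogonalML OrthogonalML.Model

/-! Write `G θ = E[m(Z, θ, h₀(X))]`, whose only zero on `Θ` is `θ₀`. The empirical moment map
converges to `G` in probability, uniformly on compact subsets `A` of `Θ`; a deterministic argument
then sends its zeros to `θ₀`.

Uniformity comes from treating `z ↦ m(z, ·, h₀(X))` as a random element of the Banach space `C(A,
ℝᵈ)`, where the strong law is already a uniform law (`IsSample.tendstoInMeasure_oracle`). Replacing
`h₀` by the estimate costs little: `m` is continuous in the nuisance and has an integrable envelope,
so `h` close to `h₀` in mean square gives a small mean error in `C(A, ℝᵈ)`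
(`exists_near_lintegral_le`). Each estimate is independent of the observation at which it is
evaluated, so Fubini carries this bound to random `h`, and Markov's inequality handles the average
(`tendstoInMeasure_average_of_perturbation`).

If `Θ` is compact, `‖G‖` is bounded below away from `θ₀`. In the convex case, `G` inherits cyclic
monotonicity from the gradients it approximates, hence points strictly outward on a small sphere
around `θ₀` (`inner_pos_of_approx`). So does the empirical map, and convexity then rules out zeros
outside the sphere (`IsConvexGradient.dist_lt_of_zero`). -/

namespace OrthogonalML

open scoped RealInnerProductSpace

/-! ### Gradients of convex functions and their uniform limits -/

section ConvexGradients

variable {d : ℕ}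

namespace Model

/-- The gradient is only taken within `Θ`, so `φ` is restricted to the segment from `x` to `y`:
there a convex function of one variable has slope at least its one-sided derivative at `0`. -/
lemma IsConvexGradient.exists_subgradient {Θ : Set (Vec d)} {F : Vec d → Vec d}
    (hF : IsConvexGradient Θ F) :
    ∃ φ : Vec d → ℝ, ∀ x ∈ Θ, ∀ y ∈ Θ, φ x + ⟪F x, y - x⟫ ≤ φ y := by
  obtain ⟨φ, hφ, hgrad⟩ := hF
  refine ⟨φ, fun x hx y hy => ?_⟩
  have hmem : ∀ t ∈ Set.Icc (0 : ℝ) 1, AffineMap.lineMap x y t ∈ Θ := fun t ht =>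
    hφ.1.segment_subset hx hy (by
      rw [segment_eq_image_lineMap]; exact ⟨t, ht, rfl⟩)
  have hconv : ConvexOn ℝ (Set.Icc (0 : ℝ) 1) (fun t => φ (AffineMap.lineMap x y t)) :=
    (hφ.comp_affineMap (AffineMap.lineMap x y)).subset hmem (convex_Icc 0 1)
  have hderiv : HasDerivWithinAt (fun t : ℝ => φ (AffineMap.lineMap x y t)) ⟪F x, y - x⟫
      (Set.Icc 0 1) 0 := by
    have h1 : HasFDerivWithinAt φ (InnerProductSpace.toDual ℝ (Vec d) (F x)) Θ
        (AffineMap.lineMap x y (0 : ℝ)) := by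
      simpa using (hgrad x hx).hasFDerivWithinAt
    have h2 : HasDerivWithinAt (fun t : ℝ => AffineMap.lineMap x y t) (y - x)
        (Set.Icc 0 1) 0 := AffineMap.hasDerivWithinAt_lineMap
    simpa [Function.comp_def] using h1.comp_hasDerivWithinAt (0 : ℝ) h2 hmem
  have h := hconv.le_slope_of_hasDerivWithinAt (by simp) (by simp) zero_lt_one hderiv
  simp only [slope_def_field, AffineMap.lineMap_apply_one, AffineMap.lineMap_apply_zero,
    sub_zero, div_one] at h
  linarith

/-- Three-point cyclic monotonicity. -/
lemma IsConvexGradient.cyclic {Θ : Set (Vec d)} {F : Vec d → Vec d}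
    (hF : IsConvexGradient Θ F) {x y z : Vec d} (hx : x ∈ Θ) (hy : y ∈ Θ) (hz : z ∈ Θ) :
    ⟪F x, y - x⟫ + ⟪F y, z - y⟫ + ⟪F z, x - z⟫ ≤ 0 := by
  obtain ⟨φ, hφ⟩ := hF.exists_subgradient
  linarith [hφ x hx y hy, hφ y hy z hz, hφ z hz x hx]

lemma cyclic_of_approx {Θ A : Set (Vec d)} (hA : A ⊆ Θ) {G : Vec d → Vec d}
    (happrox : ∀ η : ℝ, 0 < η → ∃ F, IsConvexGradient Θ F ∧ ∀ θ ∈ A, ‖F θ - G θ‖ < η)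
    {x y z : Vec d} (hx : x ∈ A) (hy : y ∈ A) (hz : z ∈ A) :
    ⟪G x, y - x⟫ + ⟪G y, z - y⟫ + ⟪G z, x - z⟫ ≤ 0 := by
  by_contra! hpos
  set s := ⟪G x, y - x⟫ + ⟪G y, z - y⟫ + ⟪G z, x - z⟫ with hs
  set C := ‖y - x‖ + ‖z - y‖ + ‖x - z‖ with hC
  have hC0 : 0 ≤ C := by positivity
  -- With this tolerance the three errors add up to at most `s * C / (C + 1) < s`.
  obtain ⟨F, hF, hFG⟩ := happrox (s / (C + 1)) (by positivity)
  have hcyc := hF.cyclic (hA hx) (hA hy) (hA hz)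
  have hbound : ∀ u ∈ A, ∀ v : Vec d, ⟪G u, v⟫ ≤ ⟪F u, v⟫ + s / (C + 1) * ‖v‖ := by
    intro u hu v
    have h1 : ⟪G u, v⟫ - ⟪F u, v⟫ = ⟪G u - F u, v⟫ := by rw [inner_sub_left]
    have h2 : ⟪G u - F u, v⟫ ≤ ‖G u - F u‖ * ‖v‖ := real_inner_le_norm _ _
    have h3 : ‖G u - F u‖ * ‖v‖ ≤ s / (C + 1) * ‖v‖ := by
      gcongr
      rw [norm_sub_rev]
      exact (hFG u hu).le
    linarith
  have hle : s ≤ s / (C + 1) * C := by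
    have h1 := hbound x hx (y - x)
    have h2 := hbound y hy (z - y)
    have h3 := hbound z hz (x - z)
    have : s / (C + 1) * C = s / (C + 1) * ‖y - x‖ + s / (C + 1) * ‖z - y‖
      + s / (C + 1) * ‖x - z‖ := by rw [hC]; ring
    linarith
  have : s / (C + 1) * C < s := by
    rw [div_mul_eq_mul_div, div_lt_iff₀ (by positivity)]
    nlinarith
  linarith

/-- A uniform limit of gradients of convex functions points strictly away from its only zero. -/
lemma inner_pos_of_approx {Θ : Set (Vec d)} {θ₀ : Vec d} {ε : ℝ} (hε : 0 < ε)
    (hA : Metric.closedBall θ₀ ε ⊆ Θ) {G : Vec d → Vec d}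
    (hcont : ContinuousOn G (Metric.closedBall θ₀ ε)) (hzero : G θ₀ = 0)
    (hne : ∀ θ ∈ Metric.closedBall θ₀ ε, θ ≠ θ₀ → G θ ≠ 0)
    (happrox : ∀ η : ℝ, 0 < η → ∃ F, IsConvexGradient Θ F ∧
      ∀ θ ∈ Metric.closedBall θ₀ ε, ‖F θ - G θ‖ < η)
    {θ : Vec d} (hθ : θ ∈ Metric.closedBall θ₀ ε) (hθne : θ ≠ θ₀) :
    0 < ⟪G θ, θ - θ₀⟫ := by
  have hθ₀ : θ₀ ∈ Metric.closedBall θ₀ ε := Metric.mem_closedBall_self hε.le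
  by_contra! hle
  -- Cyclicity along `θ₀, θ, z`: the term at `θ₀` vanishes and `hle` discards `⟪G θ, θ - θ₀⟫`.
  -- Two-point monotonicity would not suffice: a rotation by a right angle in the plane is monotone,
  -- vanishes only at the centre and satisfies `⟪G θ, θ - θ₀⟫ = 0`.
  have hkey : ∀ z ∈ Metric.closedBall θ₀ ε, ⟪G θ, z - θ₀⟫ ≤ ⟪G z, z - θ₀⟫ := by
    intro z hz
    have h := cyclic_of_approx hA happrox hθ₀ hθ hz
    rw [hzero, inner_zero_left] at h
    have h1 : ⟪G θ, z - θ⟫ = ⟪G θ, z - θ₀⟫ - ⟪G θ, θ - θ₀⟫ := by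
      rw [← inner_sub_right]; congr 1; abel
    have h2 : ⟪G z, θ₀ - z⟫ = - ⟪G z, z - θ₀⟫ := by
      rw [← inner_neg_right]; congr 1; abel
    linarith
  -- Take `z = θ₀ + t • G θ`, divide by `t` and let `t → 0+`: this gives `‖G θ‖² ≤ ⟪G θ₀, G θ⟫ = 0`.
  have hlim : Tendsto (fun t : ℝ => ⟪G (θ₀ + t • G θ), G θ⟫) (𝓝[>] 0) (𝓝 ⟪G θ₀, G θ⟫) := by
    have hpath : Tendsto (fun t : ℝ => θ₀ + t • G θ) (𝓝[>] 0) (𝓝 θ₀) := by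
      have : Continuous fun t : ℝ => θ₀ + t • G θ := by fun_prop
      simpa using (this.tendsto 0).mono_left nhdsWithin_le_nhds
    have hG : ContinuousAt G θ₀ := hcont.continuousAt (Metric.closedBall_mem_nhds θ₀ hε)
    exact (hG.tendsto.comp hpath).inner tendsto_const_nhds
  have hev : ∀ᶠ t : ℝ in 𝓝[>] 0, ⟪G θ, G θ⟫ ≤ ⟪G (θ₀ + t • G θ), G θ⟫ := by
    have hpath : Tendsto (fun t : ℝ => θ₀ + t • G θ) (𝓝[>] 0) (𝓝 θ₀) := by
      have : Continuous fun t : ℝ => θ₀ + t • G θ := by fun_prop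
      simpa using (this.tendsto 0).mono_left nhdsWithin_le_nhds
    filter_upwards [hpath.eventually (Metric.closedBall_mem_nhds θ₀ hε), self_mem_nhdsWithin]
      with t ht ht0
    have h := hkey _ ht
    simp only [add_sub_cancel_left, inner_smul_right] at h
    exact le_of_mul_le_mul_left h ht0
  have h0 : ⟪G θ, G θ⟫ ≤ 0 := by
    have := ge_of_tendsto hlim hev
    rwa [hzero, inner_zero_left] at this
  exact hne θ hθ hθne (inner_self_eq_zero.mp (le_antisymm h0 real_inner_self_nonneg))

/-- A zero `θ'` of the gradient minimizes `φ` on `Θ`. If it lay outside the open ball, the segment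
from `θ₀` to `θ'` would cross the sphere at a point from which `φ` strictly increases towards `θ'`.
-/
lemma IsConvexGradient.dist_lt_of_zero {Θ : Set (Vec d)} {F : Vec d → Vec d}
    (hF : IsConvexGradient Θ F) {θ₀ : Vec d} {ε : ℝ} (hε : 0 < ε)
    (hsphere : Metric.sphere θ₀ ε ⊆ Θ)
    (hpos : ∀ θ ∈ Metric.sphere θ₀ ε, 0 < ⟪F θ, θ - θ₀⟫)
    {θ' : Vec d} (hθ' : θ' ∈ Θ) (hzero : F θ' = 0) : dist θ' θ₀ < ε := by
  by_contra! hle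
  have hd : 0 < ‖θ' - θ₀‖ := by rw [← dist_eq_norm]; linarith
  rw [dist_eq_norm] at hle
  set s := ε / ‖θ' - θ₀‖ with hs
  have hs0 : 0 < s := by positivity
  have hs1 : s ≤ 1 := (div_le_one hd).mpr hle
  set θ := θ₀ + s • (θ' - θ₀) with hθ
  have hmem : θ ∈ Metric.sphere θ₀ ε := by
    rw [mem_sphere_iff_norm, hθ, add_sub_cancel_left, norm_smul, Real.norm_of_nonneg hs0.le, hs,
      div_mul_cancel₀ _ hd.ne']
  have hp := hpos θ hmem
  obtain ⟨φ, hφ⟩ := hF.exists_subgradient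
  have h1 := hφ θ (hsphere hmem) θ' hθ'
  have h2 := hφ θ' hθ' θ (hsphere hmem)
  rw [hzero, inner_zero_left] at h2
  have h3 : θ' - θ = (1 - s) • (θ' - θ₀) := by rw [hθ]; module
  rw [h3, inner_smul_right] at h1
  rw [show θ - θ₀ = s • (θ' - θ₀) by rw [hθ, add_sub_cancel_left], inner_smul_right] at hp
  have hp' : 0 < ⟪F θ, θ' - θ₀⟫ := (pos_iff_pos_of_mul_pos hp).mp hs0
  -- If `s = 1`, then `θ'` is itself on the sphere, where `F` cannot vanish.
  rcases hs1.eq_or_lt with h | h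
  · have : θ = θ' := by rw [hθ, h]; module
    rw [this, hzero, inner_zero_left] at hp'
    exact lt_irrefl _ hp'
  · nlinarith [mul_pos (sub_pos.mpr h) hp']

end Model

end ConvexGradients

/-! ### From uniform convergence of moments to convergence of zeros -/

section Consistency

variable {d : ℕ} {Ω : Type*} [MeasurableSpace Ω] {μ : Measure Ω} {L : Filter ℕ}

lemma exists_pos_le_of_isCompact {X : Type*} [TopologicalSpace X] {B : Set X} (hB : IsCompact B)
    {f : X → ℝ} (hf : ContinuousOn f B) (hpos : ∀ x ∈ B, 0 < f x) :
    ∃ c : ℝ, 0 < c ∧ ∀ x ∈ B, c ≤ f x := by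
  rcases B.eq_empty_or_nonempty with rfl | hne
  · exact ⟨1, one_pos, by simp⟩
  · obtain ⟨x, hx, hmin⟩ := hB.exists_isMinOn hne hf
    exact ⟨f x, hpos x hx, fun y hy => hmin hy⟩

lemma tendsto_measure_zero_of_ae_subset {s t : ℕ → Set Ω}
    (ht : Tendsto (fun n => μ (t n)) L (𝓝 0)) (hst : ∀ᶠ n in L, ∀ᵐ ω ∂μ, ω ∈ s n → ω ∈ t n) :
    Tendsto (fun n => μ (s n)) L (𝓝 0) :=
  tendsto_of_tendsto_of_tendsto_of_le_of_le' tendsto_const_nhds ht (Eventually.of_forall (by simp))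
    (hst.mono fun _ h => measure_mono_ae h)

lemma tendsto_measure_union_zero {s t : ℕ → Set Ω} (hs : Tendsto (fun n => μ (s n)) L (𝓝 0))
    (ht : Tendsto (fun n => μ (t n)) L (𝓝 0)) : Tendsto (fun n => μ (s n ∪ t n)) L (𝓝 0) :=
  tendsto_of_tendsto_of_tendsto_of_le_of_le tendsto_const_nhds (by simpa using hs.add ht)
    (fun _ => zero_le) (fun _ => measure_union_le _ _)

namespace Model

/-- Zeros of empirical moment maps that converge uniformly in probability on compact sets converge
in probability to the zero of the limit. -/
theorem tendstoInMeasure_of_uniform [IsProbabilityMeasure μ]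
    {𝒵 𝒳 : Type*} [MeasurableSpace 𝒵] [MeasurableSpace 𝒳] {l : ℕ} (M : Model 𝒵 𝒳 d l)
    {F : ℕ → Ω → Vec d → Vec d} {G : Vec d → Vec d}
    (hCC : M.CompactOrConvex μ L F)
    (hG : ∀ A ⊆ M.Θ, IsCompact A → ContinuousOn G A)
    (hunif : ∀ A ⊆ M.Θ, IsCompact A → ∀ η : ℝ, 0 < η →
      Tendsto (fun n => μ {ω | ¬ ∀ θ ∈ A, ‖F n ω θ - G θ‖ < η}) L (𝓝 0))
    (hzero : G M.θ₀ = 0) (hne : ∀ θ ∈ M.Θ, θ ≠ M.θ₀ → G θ ≠ 0)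
    {θhat : ℕ → Ω → Vec d}
    (hθhat : ∀ᶠ n in L, ∀ᵐ ω ∂μ, θhat n ω ∈ M.Θ ∧ F n ω (θhat n ω) = 0) :
    TendstoInMeasure μ θhat L (fun _ => M.θ₀) := by
  rw [tendstoInMeasure_iff_dist]
  intro ε₀ hε₀
  rcases hCC with hK | ⟨-, hint, hconv⟩
  · obtain ⟨c, hc, hcle⟩ := exists_pos_le_of_isCompact
      (B := M.Θ ∩ {θ | ε₀ ≤ dist θ M.θ₀}) (f := fun θ => ‖G θ‖)
      (hK.inter_right (isClosed_le continuous_const (by fun_prop)))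
      ((hG _ subset_rfl hK).norm.mono Set.inter_subset_left)
      (fun θ hθ => norm_pos_iff.mpr <| hne θ hθ.1 <| by
        rintro rfl
        have : ε₀ ≤ dist M.θ₀ M.θ₀ := hθ.2
        rw [dist_self] at this
        linarith)
    refine tendsto_measure_zero_of_ae_subset (hunif _ subset_rfl hK c hc) ?_
    filter_upwards [hθhat] with n hn
    filter_upwards [hn] with ω hω hfar hclose
    have h1 := hclose _ hω.1
    rw [hω.2, zero_sub, norm_neg] at h1
    exact absurd (hcle _ ⟨hω.1, hfar⟩) (not_le.mpr h1)
  -- A nontrivial filter is needed to pick a single `n` below.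
  · rcases L.eq_or_neBot with rfl | hL
    · exact tendsto_bot
    obtain ⟨ε₁, hε₁, hball⟩ := Metric.mem_nhds_iff.mp (mem_interior_iff_mem_nhds.mp hint)
    set ε := min ε₀ (ε₁ / 2) with hε_def
    have hε : 0 < ε := by positivity
    have hA : Metric.closedBall M.θ₀ ε ⊆ M.Θ :=
      (Metric.closedBall_subset_ball (by
        have : ε ≤ ε₁ / 2 := min_le_right _ _
        linarith)).trans hball
    have hAc : IsCompact (Metric.closedBall M.θ₀ ε) := isCompact_closedBall _ _
    have hGA := hG _ hA hAc
    have hbad : ∀ η : ℝ, 0 < η → Tendsto (fun n => μ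
        ({ω | ¬ ∀ θ ∈ Metric.closedBall M.θ₀ ε, ‖F n ω θ - G θ‖ < η} ∪
          {ω | ¬ IsConvexGradient M.Θ (F n ω)})) L (𝓝 0) := fun η hη =>
      tendsto_measure_union_zero (hunif _ hA hAc η hη) hconv
    have happrox : ∀ η : ℝ, 0 < η → ∃ F', IsConvexGradient M.Θ F' ∧
        ∀ θ ∈ Metric.closedBall M.θ₀ ε, ‖F' θ - G θ‖ < η := by
      intro η hη
      -- The bad event has outer measure below one, so it misses some `ω`; there the empirical map
      -- is a convex gradient within `η` of `G`. No measurability is needed.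
      obtain ⟨n, hn⟩ := ((hbad η hη).eventually (gt_mem_nhds zero_lt_one)).exists
      by_contra! hno
      refine hn.ne ?_
      rw [← measure_univ (μ := μ)]
      congr 1
      refine Set.eq_univ_of_forall fun ω => ?_
      by_cases hω : IsConvexGradient M.Θ (F n ω)
      · left
        obtain ⟨θ, hθ, hle⟩ := hno _ hω
        exact fun h => absurd (h θ hθ) (not_lt.mpr hle)
      · exact Or.inr hω
    have hpos : ∀ θ ∈ Metric.sphere M.θ₀ ε, 0 < ⟪G θ, θ - M.θ₀⟫ := fun θ hθ =>
      inner_pos_of_approx hε hA hGA hzero (fun θ hθ => hne θ (hA hθ)) happrox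
        (Metric.sphere_subset_closedBall hθ) (Metric.ne_of_mem_sphere hθ hε.ne')
    obtain ⟨c, hc, hcle⟩ := exists_pos_le_of_isCompact (isCompact_sphere M.θ₀ ε)
      ((hGA.mono Metric.sphere_subset_closedBall).inner (by fun_prop)) hpos
    -- An error below `c / ε` changes the inner product with a vector of length `ε` by less than
    -- `c`, which keeps it positive on the sphere.
    refine tendsto_measure_zero_of_ae_subset (hbad (c / ε) (by positivity)) ?_
    filter_upwards [hθhat] with n hn
    filter_upwards [hn] with ω hω hfar
    by_contra hgood
    simp only [Set.mem_union, Set.mem_ofPred_eq, not_or, not_not] at hgood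
    have hlt : dist (θhat n ω) M.θ₀ < ε := by
      refine hgood.2.dist_lt_of_zero hε (Metric.sphere_subset_closedBall.trans hA)
        (fun θ hθ => ?_) hω.1 hω.2
      have h1 := hgood.1 θ (Metric.sphere_subset_closedBall hθ)
      have h2 := hcle θ hθ
      have h3 : ⟪G θ - F n ω θ, θ - M.θ₀⟫ ≤ ‖G θ - F n ω θ‖ * ‖θ - M.θ₀‖ := real_inner_le_norm _ _
      rw [inner_sub_left, mem_sphere_iff_norm.mp hθ, norm_sub_rev] at h3
      have h4 : ‖F n ω θ - G θ‖ * ε < c := (lt_div_iff₀ hε).mp h1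
      linarith
    have hfar' : ε₀ ≤ dist (θhat n ω) M.θ₀ := hfar
    linarith [min_le_left ε₀ (ε₁ / 2)]

end Model

end Consistency

/-! ### Borel measurability in spaces of continuous maps -/

section ContinuousMapMeasurability

instance continuousMapMeasurableSpace {A E : Type*} [TopologicalSpace A] [TopologicalSpace E] :
    MeasurableSpace C(A, E) := borel _

instance continuousMapBorelSpace {A E : Type*} [TopologicalSpace A] [TopologicalSpace E] :
    BorelSpace C(A, E) := ⟨rfl⟩

/-- By second countability, every open set is a countable union of closed balls contained in it. -/
lemma measurable_of_measurableSet_closedBall {α Y : Type*} [MeasurableSpace α]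
    [PseudoMetricSpace Y] [SecondCountableTopology Y] [MeasurableSpace Y] [BorelSpace Y]
    {F : α → Y} (hF : ∀ y, ∀ r : ℝ, MeasurableSet (F ⁻¹' Metric.closedBall y r)) :
    Measurable F := by
  refine measurable_of_isOpen fun U hU => ?_
  have h : ∀ y ∈ U, ∃ r : ℝ, 0 < r ∧ Metric.closedBall y r ⊆ U := fun y hy =>
    Metric.nhds_basis_closedBall.mem_iff.mp (hU.mem_nhds hy)
  choose! r hr hsub using h
  obtain ⟨t, htU, htc, ht⟩ := TopologicalSpace.countable_cover_nhdsWithin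
    (f := fun y => Metric.closedBall y (r y))
    fun y hy => mem_nhdsWithin_of_mem_nhds (Metric.closedBall_mem_nhds y (hr y hy))
  have : U = ⋃ y ∈ t, Metric.closedBall y (r y) :=
    ht.antisymm (Set.iUnion₂_subset fun y hy => hsub y (htU hy))
  rw [this, Set.preimage_iUnion₂]
  exact MeasurableSet.biUnion htc fun y _ => hF y _

/-- A closed ball for the sup norm is cut out by evaluations at a countable dense set. This makes
the moment field a random element to which the strong law applies. -/
lemma measurable_continuousMap {α A E : Type*} [MeasurableSpace α] [MetricSpace A]
    [CompactSpace A] [NormedAddCommGroup E] [SecondCountableTopology E] [MeasurableSpace E]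
    [BorelSpace E] {F : α → C(A, E)} (hF : ∀ a, Measurable fun x => F x a) : Measurable F := by
  refine measurable_of_measurableSet_closedBall fun y r => ?_
  rcases lt_or_ge r 0 with hr | hr
  · simp [Metric.closedBall_eq_empty.mpr hr]
  obtain ⟨D, hDc, hD⟩ := TopologicalSpace.exists_countable_dense A
  have : F ⁻¹' Metric.closedBall y r = ⋂ a ∈ D, {x | dist (F x a) (y a) ≤ r} := by
    ext x
    simp only [Set.mem_preimage, Metric.mem_closedBall, Set.mem_iInter, Set.mem_ofPred_eq]
    refine ⟨fun h a _ => (ContinuousMap.dist_le hr).mp h a,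
      fun h => (ContinuousMap.dist_le hr).mpr fun a => ?_⟩
    have hcl : IsClosed {a | dist (F x a) (y a) ≤ r} :=
      isClosed_le (by fun_prop) continuous_const
    exact (hcl.closure_subset_iff.mpr fun a ha => h a ha) (hD a)
  rw [this]
  exact MeasurableSet.biInter hDc fun a _ => measurableSet_le ((hF a).dist measurable_const)
    measurable_const

end ContinuousMapMeasurability

/-! ### Perturbed averages and integration over independent variables -/

section Averages

variable {Ω : Type*} [MeasurableSpace Ω] {μ : Measure Ω}

/-- Averages of perturbed random vectors have the limit in probability of the unperturbed averages
if the perturbations are uniformly small in mean on events of probability tending to one. -/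
lemma tendstoInMeasure_average_of_perturbation {E : Type*} [NormedAddCommGroup E] [NormedSpace ℝ E]
    {L : Filter ℕ} {N : ℕ → ℕ} {Y : ℕ → Ω → E} {Y' : ℕ → ℕ → Ω → E} {c : E}
    (hY : TendstoInMeasure μ (fun n ω => (N n : ℝ)⁻¹ • ∑ t ∈ Finset.range (N n), Y t ω) L
      (fun _ => c))
    (hY' : ∀ ε : ℝ≥0∞, 0 < ε → ∃ B : ℕ → Set Ω, Tendsto (fun n => μ (B n)) L (𝓝 0) ∧
      ∀ᶠ n in L, MeasurableSet (B n) ∧ ∀ t < N n,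
        AEMeasurable (fun ω => ‖Y' n t ω - Y t ω‖ₑ) μ ∧
        ∫⁻ ω in (B n)ᶜ, ‖Y' n t ω - Y t ω‖ₑ ∂μ ≤ ε) :
    TendstoInMeasure μ (fun n ω => (N n : ℝ)⁻¹ • ∑ t ∈ Finset.range (N n), Y' n t ω) L
      (fun _ => c) := by
  refine tendstoInMeasure_of_ne_top fun ε hε hεtop => ?_
  have hε2 : 0 < ε / 2 := ENNReal.half_pos hε.ne'
  have hε2top : ε / 2 ≠ ∞ := ENNReal.div_ne_top hεtop (by simp)
  set D : ℕ → Ω → ℝ≥0∞ := fun n ω =>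
    (N n : ℝ≥0∞)⁻¹ * ∑ t ∈ Finset.range (N n), ‖Y' n t ω - Y t ω‖ₑ with hD
  have hedist : ∀ n ω, edist ((N n : ℝ)⁻¹ • ∑ t ∈ Finset.range (N n), Y' n t ω)
      ((N n : ℝ)⁻¹ • ∑ t ∈ Finset.range (N n), Y t ω) ≤ D n ω := by
    intro n ω
    rw [edist_eq_enorm_sub, ← smul_sub, ← Finset.sum_sub_distrib, enorm_smul]
    rcases Nat.eq_zero_or_pos (N n) with h0 | h0
    · simp [h0]
    · refine mul_le_mul' (le_of_eq ?_) (enorm_sum_le _ _)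
      rw [enorm_inv (by positivity), Real.enorm_natCast]
  have hDsmall : Tendsto (fun n => μ {ω | ε / 2 ≤ D n ω}) L (𝓝 0) := by
    rw [ENNReal.tendsto_nhds_zero]
    intro η hη
    rcases eq_or_ne η ∞ with rfl | hηtop
    · simp
    have hη2 : 0 < η / 2 := ENNReal.half_pos hη.ne'
    -- Markov's inequality at level `ε / 2` turns this mean bound into probability at most `η / 2`;
    -- the exceptional set `B n` takes the other `η / 2`.
    obtain ⟨B, hB, hev⟩ := hY' (ε / 2 * (η / 2)) (ENNReal.mul_pos hε2.ne' hη2.ne')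
    filter_upwards [hev, (ENNReal.tendsto_nhds_zero.mp hB) (η / 2) hη2] with n ⟨hBn, hn⟩ hBsmall
    have hDm : AEMeasurable (D n) μ :=
      (Finset.aemeasurable_fun_sum _ fun t ht => (hn t (Finset.mem_range.mp ht)).1).const_mul _
    have hDint : ∫⁻ ω in (B n)ᶜ, D n ω ∂μ ≤ ε / 2 * (η / 2) := by
      rw [hD, lintegral_const_mul'' _ (Finset.aemeasurable_fun_sum _ fun t ht =>
          (hn t (Finset.mem_range.mp ht)).1.restrict),
        lintegral_finsetSum' _ fun t ht => (hn t (Finset.mem_range.mp ht)).1.restrict]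
      calc (N n : ℝ≥0∞)⁻¹ * ∑ t ∈ Finset.range (N n), ∫⁻ ω in (B n)ᶜ, ‖Y' n t ω - Y t ω‖ₑ ∂μ
          ≤ (N n : ℝ≥0∞)⁻¹ * ∑ t ∈ Finset.range (N n), ε / 2 * (η / 2) := by
            gcongr with t ht
            exact (hn t (Finset.mem_range.mp ht)).2
        _ = ((N n : ℝ≥0∞)⁻¹ * N n) * (ε / 2 * (η / 2)) := by
            rw [Finset.sum_const, Finset.card_range, nsmul_eq_mul, mul_assoc]
        _ ≤ 1 * (ε / 2 * (η / 2)) := by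
            gcongr
            exact ENNReal.inv_mul_le_one _
        _ = ε / 2 * (η / 2) := one_mul _
    have hmarkov : μ ({ω | ε / 2 ≤ D n ω} ∩ (B n)ᶜ) ≤ η / 2 := by
      have h1 := (mul_meas_ge_le_lintegral₀ (hDm.restrict (s := (B n)ᶜ)) (ε / 2)).trans hDint
      rw [Measure.restrict_apply' hBn.compl] at h1
      exact (ENNReal.mul_le_mul_iff_right hε2.ne' hε2top).mp h1
    calc μ {ω | ε / 2 ≤ D n ω} ≤ μ (({ω | ε / 2 ≤ D n ω} ∩ (B n)ᶜ) ∪ B n) := by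
          refine measure_mono fun ω hω => ?_
          by_cases hωB : ω ∈ B n
          · exact Or.inr hωB
          · exact Or.inl ⟨hω, hωB⟩
      _ ≤ η / 2 + η / 2 := (measure_union_le _ _).trans (add_le_add hmarkov hBsmall)
      _ = η := ENNReal.add_halves η
  refine tendsto_measure_zero_of_ae_subset
    (tendsto_measure_union_zero hDsmall (hY (ε / 2) hε2)) (Eventually.of_forall fun n =>
      Eventually.of_forall fun ω hω => ?_)
  by_contra hno
  simp only [Set.mem_union, Set.mem_ofPred_eq, not_or, not_le] at hno
  have h1 : ε ≤ edist ((N n : ℝ)⁻¹ • ∑ t ∈ Finset.range (N n), Y' n t ω) c := hω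
  have h2 := h1.trans ((edist_triangle _ _ c).trans (add_le_add_left (hedist n ω) _))
  have h3 := ENNReal.add_lt_add hno.1 hno.2
  rw [ENNReal.add_halves] at h3
  exact absurd h2 (not_le.mpr h3)

/-- Integrals over two independent variables are bounded by bounds on the sections. -/
lemma setLIntegral_le_of_indepFun [IsProbabilityMeasure μ] {W 𝒵 : Type*} [MeasurableSpace W]
    [MeasurableSpace 𝒵] {D : Ω → W} {ζ : Ω → 𝒵} (hD : Measurable D) (hζ : Measurable ζ)
    (hind : IndepFun D ζ μ) {φ : W × 𝒵 → ℝ≥0∞} (hφ : Measurable φ) {S : Set W}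
    (hS : MeasurableSet S) {ε : ℝ≥0∞} (hbound : ∀ w ∈ S, ∫⁻ z, φ (w, z) ∂(μ.map ζ) ≤ ε) :
    ∫⁻ ω in D ⁻¹' S, φ (D ω, ζ ω) ∂μ ≤ ε := by
  have hprobD := Measure.isProbabilityMeasure_map hD.aemeasurable (μ := μ)
  have hprobζ := Measure.isProbabilityMeasure_map hζ.aemeasurable (μ := μ)
  have hmap := (indepFun_iff_map_prod_eq_prod_map_map hD.aemeasurable hζ.aemeasurable).mp hind
  have hpre : D ⁻¹' S = (fun ω => (D ω, ζ ω)) ⁻¹' (S ×ˢ Set.univ) := by ext; simp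
  rw [hpre, ← setLIntegral_map (hS.prod .univ) hφ (hD.prodMk hζ), hmap,
    ← Measure.prod_restrict, Measure.restrict_univ, lintegral_prod _ hφ.aemeasurable]
  calc ∫⁻ w in S, ∫⁻ z, φ (w, z) ∂(μ.map ζ) ∂(μ.map D)
      ≤ ∫⁻ _ in S, ε ∂(μ.map D) := setLIntegral_mono' hS hbound
    _ = ε * μ.map D S := setLIntegral_const _ _
    _ ≤ ε * 1 := by gcongr; exact prob_le_one
    _ = ε := mul_one _

end Averages

namespace Model

variable {𝒵 𝒳 : Type*} [MeasurableSpace 𝒵] [MeasurableSpace 𝒳] {d l : ℕ}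

/-! ### Nuisance errors and neighbourhoods of `h₀` -/

section Nuisance

variable (M : Model 𝒵 𝒳 d l)

/-- The members of `nuisanceBall k r` within squared distance `δ` of `h₀` in each coordinate. -/
def nuisanceNear (k : ℕ) (r : ℝ) (δ : ℝ≥0∞) : Set (𝒳 → Vec l) :=
  {h ∈ M.nuisanceBall k r | ∀ i, M.nuisanceError 2 (Pi.single i 1) h ≤ δ}

lemma nuisanceError_two_single (i : Fin l) (h : 𝒳 → Vec l) :
    M.nuisanceError 2 (Pi.single i 1) h =
      ∫⁻ z, ‖h (M.X z) i - M.h₀ (M.X z) i‖ₑ ^ 2 ∂M.P := by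
  refine lintegral_congr fun z => ?_
  rw [Finset.prod_eq_single i (fun j _ hj => by simp [Pi.single_eq_of_ne hj]) (by simp)]
  simp

lemma measurable_h₀ : Measurable M.h₀ := M.measurable_H _ M.h₀_mem

lemma measurable_nuisanceError {W : Type*} [MeasurableSpace W] {g : W → 𝒳 → Vec l}
    (hg : Measurable fun q : W × 𝒳 => g q.1 q.2) (c : ℕ) (α : Fin l → ℕ) :
    Measurable fun w => M.nuisanceError c α (g w) := by
  have := M.isProb
  have hX := M.measurable_X
  have hh₀ := M.measurable_h₀
  have hgX : Measurable fun q : W × 𝒵 => g q.1 (M.X q.2) :=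
    hg.comp (measurable_fst.prodMk (hX.comp measurable_snd))
  have : Measurable fun q : W × 𝒵 =>
      ∏ i, ‖g q.1 (M.X q.2) i - M.h₀ (M.X q.2) i‖ₑ ^ (c * α i) := by
    refine Finset.measurable_fun_prod _ fun i _ => ?_
    have h1 : Measurable fun q : W × 𝒵 => g q.1 (M.X q.2) i := by fun_prop
    have h2 : Measurable fun q : W × 𝒵 => M.h₀ (M.X q.2) i := by fun_prop
    exact (h1.sub h2).enorm.pow_const _
  exact this.lintegral_prod_right'

/-- Multi-indices are countable, so the ball conditions form a countable intersection of measurable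
sets. -/
lemma IsProcedure.measurableSet_near {M : Model 𝒵 𝒳 d l} {ι : Type*} {g : (ι → 𝒵) → 𝒳 → Vec l}
    (hg : M.IsProcedure g) (k : ℕ) (r : ℝ) (δ : ℝ≥0∞) :
    MeasurableSet {w | g w ∈ M.nuisanceNear k r δ} := by
  have hm := M.measurable_nuisanceError hg.measurable
  have : {w | g w ∈ M.nuisanceNear k r δ} =
      (⋂ α : Fin l → ℕ, ⋂ _ : α ≠ 0, ⋂ _ : absIndex α ≤ k + 1,
        {w | M.nuisanceError 2 α (g w) ≤ ENNReal.ofReal r}) ∩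
      ⋂ i, {w | M.nuisanceError 2 (Pi.single i 1) (g w) ≤ δ} := by
    ext w
    simp [nuisanceNear, nuisanceBall, hg.mem w]
  rw [this]
  refine MeasurableSet.inter ?_ ?_
  · exact .iInter fun α => .iInter fun _ => .iInter fun _ =>
      measurableSet_le (hm 2 α) measurable_const
  · exact .iInter fun i => measurableSet_le (hm 2 _) measurable_const

lemma h₀_mem_nuisanceBall (k : ℕ) (r : ℝ) : M.h₀ ∈ M.nuisanceBall k r := by
  refine ⟨M.h₀_mem, fun α hα _ => ?_⟩
  obtain ⟨i, hi⟩ := Function.ne_iff.mp hα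
  have : M.nuisanceError 2 α M.h₀ = 0 := by
    unfold nuisanceError
    refine (lintegral_congr fun z => ?_).trans lintegral_zero
    exact Finset.prod_eq_zero (Finset.mem_univ i) (by simpa using hi)
  simp [this]

/-- Pointwise, `u ≤ η + η⁻¹ u²` with `u` the product of even powers: either `u ≤ η`, or `η u ≤ u²`.
-/
lemma nuisanceError_two_le (α : Fin l → ℕ) (h : 𝒳 → Vec l) {η : ℝ≥0∞} (hη : 0 < η)
    (hηtop : η ≠ ∞) :
    M.nuisanceError 2 α h ≤ η + η⁻¹ * M.nuisanceError 4 α h := by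
  have := M.isProb
  unfold nuisanceError
  rw [← lintegral_const_mul' _ _ (ENNReal.inv_ne_top.mpr hη.ne')]
  calc ∫⁻ z, ∏ i, ‖h (M.X z) i - M.h₀ (M.X z) i‖ₑ ^ (2 * α i) ∂M.P
      ≤ ∫⁻ z, (η + η⁻¹ * ∏ i, ‖h (M.X z) i - M.h₀ (M.X z) i‖ₑ ^ (4 * α i)) ∂M.P := by
        refine lintegral_mono fun z => ?_
        have hsq : ∏ i, ‖h (M.X z) i - M.h₀ (M.X z) i‖ₑ ^ (4 * α i) =
            (∏ i, ‖h (M.X z) i - M.h₀ (M.X z) i‖ₑ ^ (2 * α i)) *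
            ∏ i, ‖h (M.X z) i - M.h₀ (M.X z) i‖ₑ ^ (2 * α i) := by
          rw [← Finset.prod_mul_distrib]
          exact Finset.prod_congr rfl fun i _ => by rw [← pow_add]; congr 1; ring
        simp only [hsq]
        set u := ∏ i, ‖h (M.X z) i - M.h₀ (M.X z) i‖ₑ ^ (2 * α i)
        rcases le_total u η with hu | hu
        · exact hu.trans le_self_add
        · calc u = η⁻¹ * (η * u) := by
                rw [← mul_assoc, ENNReal.inv_mul_cancel hη.ne' hηtop, one_mul]
            _ ≤ η⁻¹ * (u * u) := by gcongr
            _ ≤ η + η⁻¹ * (u * u) := le_add_self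
    _ = η + ∫⁻ z, η⁻¹ * ∏ i, ‖h (M.X z) i - M.h₀ (M.X z) i‖ₑ ^ (4 * α i) ∂M.P := by
        rw [lintegral_add_left measurable_const]
        simp

end Nuisance

/-! ### Consistency of the first stage -/

section FirstStage

variable {M : Model 𝒵 𝒳 d l} {S : Finset (Fin l → ℕ)} {Ω : Type*} [MeasurableSpace Ω]
  {μ : Measure Ω} {L : Filter ℕ} {hhat : ℕ → Ω → 𝒳 → Vec l}

lemma toProbZero_of_ne_top {Y : ℕ → Ω → ℝ≥0∞}
    (h : ∀ ε : ℝ≥0∞, 0 < ε → ε ≠ ∞ → Tendsto (fun n => μ {ω | ε ≤ Y n ω}) L (𝓝 0)) :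
    ToProbZero μ L Y := by
  intro ε hε
  refine tendsto_measure_zero_of_ae_subset
    (h (min ε 1) (lt_min hε one_pos) (ne_top_of_le_ne_top ENNReal.one_ne_top (min_le_right _ _)))
    (Eventually.of_forall fun n => Eventually.of_forall fun ω hω => (min_le_left ε 1).trans hω)

/-- For `α ∈ S` the fourth-power errors control the second-power ones; for `α ∉ S` the rate
condition is stronger, since its factor `√n` is at least one. -/
lemma FirstStageAssumptions.toProbZero_two (hfs : M.FirstStageAssumptions S μ L hhat)
    (hL : L ≤ atTop) {α : Fin l → ℕ} (hα : α ≠ 0) (hαk : absIndex α ≤ maxOrder S + 1) :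
    ToProbZero μ L (fun n ω => M.nuisanceError 2 α (hhat n ω)) := by
  refine toProbZero_of_ne_top fun ε hε hεtop => ?_
  by_cases hαS : α ∈ S
  · have hε2 : 0 < ε / 2 := ENNReal.half_pos hε.ne'
    have hε2top : ε / 2 ≠ ∞ := ENNReal.div_ne_top hεtop (by simp)
    refine tendsto_measure_zero_of_ae_subset
      (hfs.consistency α hαS hα (ε / 2 * (ε / 2)) (ENNReal.mul_pos hε2.ne' hε2.ne'))
      (Eventually.of_forall fun n => Eventually.of_forall fun ω hω => ?_)
    have h1 : ε / 2 + ε / 2 ≤ ε / 2 + (ε / 2)⁻¹ * M.nuisanceError 4 α (hhat n ω) := by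
      rw [ENNReal.add_halves]
      exact le_trans hω (M.nuisanceError_two_le α _ hε2 hε2top)
    have h2 := (ENNReal.add_le_add_iff_left hε2top).mp h1
    calc ε / 2 * (ε / 2) ≤ ε / 2 * ((ε / 2)⁻¹ * M.nuisanceError 4 α (hhat n ω)) := by gcongr
      _ = M.nuisanceError 4 α (hhat n ω) := by
        rw [← mul_assoc, ENNReal.mul_inv_cancel hε2.ne' hε2top, one_mul]
  · refine tendsto_measure_zero_of_ae_subset
      (hfs.rate α hα hαk hαS (ε ^ (1 / 2 : ℝ)) (ENNReal.rpow_pos hε hεtop)) ?_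
    filter_upwards [hL (eventually_ge_atTop 1)] with n hn
    refine Eventually.of_forall fun ω hω => ?_
    calc ε ^ (1 / 2 : ℝ) ≤ M.nuisanceError 2 α (hhat n ω) ^ (1 / 2 : ℝ) :=
          ENNReal.rpow_le_rpow hω (by norm_num)
      _ ≤ (n : ℝ≥0∞) ^ (1 / 2 : ℝ) * M.nuisanceError 2 α (hhat n ω) ^ (1 / 2 : ℝ) := by
        refine le_mul_of_one_le_left zero_le ?_
        exact ENNReal.one_le_rpow (by exact_mod_cast hn) (by norm_num)

lemma finite_absIndex_le (b : ℕ) : {α : Fin l → ℕ | absIndex α ≤ b}.Finite :=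
  (Set.finite_Iic (fun _ : Fin l => b)).subset fun α hα i =>
    (Finset.single_le_sum (f := α) (fun _ _ => Nat.zero_le _) (Finset.mem_univ i)).trans hα

/-- First-stage estimates are close to `h₀` with probability tending to one. -/
lemma FirstStageAssumptions.tendsto_near (hfs : M.FirstStageAssumptions S μ L hhat)
    (hL : L ≤ atTop) (hH : ∀ᶠ n in L, ∀ ω, hhat n ω ∈ M.H) {r : ℝ} (hr : 0 < r) {δ : ℝ≥0∞}
    (hδ : 0 < δ) :
    Tendsto (fun n => μ {ω | hhat n ω ∉ M.nuisanceNear (maxOrder S) r δ}) L (𝓝 0) := by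
  set T := (finite_absIndex_le (l := l) (maxOrder S + 1)).toFinset.filter (· ≠ 0) with hT
  have hmemT : ∀ α : Fin l → ℕ, α ∈ T ↔ absIndex α ≤ maxOrder S + 1 ∧ α ≠ 0 := by
    intro α
    simp [hT]
  set η := min (ENNReal.ofReal r) δ with hη
  have hη0 : 0 < η := lt_min (ENNReal.ofReal_pos.mpr hr) hδ
  have hsum : Tendsto (fun n => ∑ α ∈ T, μ {ω | η ≤ M.nuisanceError 2 α (hhat n ω)}) L (𝓝 0) := by
    rw [← Finset.sum_const_zero (ι := Fin l → ℕ) (s := T)]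
    exact tendsto_finsetSum _ fun α hα =>
      hfs.toProbZero_two hL ((hmemT α).mp hα).2 ((hmemT α).mp hα).1 η hη0
  have hunion : Tendsto (fun n => μ (⋃ α ∈ T, {ω | η ≤ M.nuisanceError 2 α (hhat n ω)})) L (𝓝 0) :=
    tendsto_of_tendsto_of_tendsto_of_le_of_le tendsto_const_nhds hsum (fun _ => zero_le)
      fun n => measure_biUnion_finset_le _ _
  refine tendsto_measure_zero_of_ae_subset hunion ?_
  filter_upwards [hH] with n hn
  refine Eventually.of_forall fun ω hω => ?_
  by_contra hno
  simp only [Set.mem_iUnion, Set.mem_ofPred_eq, not_exists, not_le] at hno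
  refine hω ⟨⟨hn ω, fun α hα hαk => ?_⟩, fun i => ?_⟩
  · exact (hno α ((hmemT α).mpr ⟨hαk, hα⟩)).le.trans (min_le_left _ _)
  · refine (hno _ ((hmemT _).mpr ⟨?_, ?_⟩)).le.trans (min_le_right _ _)
    · simp [absIndex]
    · simp

end FirstStage

/-! ### The moment as a random continuous function of the parameter -/

section MomentField

variable (M : Model 𝒵 𝒳 d l)

/-- The moments at nuisance value `γ`, as a continuous function of the parameter in `A`. -/
def momentField (hm : ∀ z, Continuous fun q : Vec d × Vec l => M.m z q.1 q.2) (A : Set (Vec d))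
    (z : 𝒵) : C(Vec l, C(A, Vec d)) :=
  ContinuousMap.curry ⟨fun q : Vec l × A => M.m z q.2 q.1,
    (hm z).comp ((continuous_subtype_val.comp continuous_snd).prodMk continuous_fst)⟩

variable {M} {hm : ∀ z, Continuous fun q : Vec d × Vec l => M.m z q.1 q.2} {A : Set (Vec d)}

@[simp]
lemma momentField_apply (z : 𝒵) (γ : Vec l) (θ : A) :
    M.momentField hm A z γ θ = M.m z θ γ := rfl

variable [CompactSpace A]

lemma measurable_momentField : Measurable fun q : 𝒵 × Vec l => M.momentField hm A q.1 q.2 :=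
  measurable_continuousMap fun θ => by
    have := M.measurable_m.comp (measurable_fst.prodMk
      ((measurable_const (a := (θ : Vec d))).prodMk measurable_snd) :
        Measurable fun q : 𝒵 × Vec l => (q.1, (θ : Vec d), q.2))
    exact this

lemma measurable_momentField_comp {h : 𝒳 → Vec l} (hh : Measurable h) :
    Measurable fun z => M.momentField hm A z (h (M.X z)) :=
  measurable_momentField.comp (measurable_id.prodMk (hh.comp M.measurable_X))

lemma enorm_continuousMap_le {Y E : Type*} [TopologicalSpace Y] [CompactSpace Y]
    [NormedAddCommGroup E] {f : C(Y, E)} {c : ℝ≥0∞} (h : ∀ y, ‖f y‖ₑ ≤ c) : ‖f‖ₑ ≤ c := by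
  rcases eq_or_ne c ∞ with rfl | hc
  · exact le_top
  rw [← ofReal_norm, ENNReal.ofReal_le_iff_le_toReal hc,
    ContinuousMap.norm_le _ ENNReal.toReal_nonneg]
  intro y
  rw [← ENNReal.ofReal_le_iff_le_toReal hc, ofReal_norm]
  exact h y

/-- Finite outer expectation supplies one measurable integrable majorant valid for all `h` in the
ball at once. -/
lemma exists_envelope {k : ℕ} {r : ℝ}
    (hdom : outerExpect M.P (fun z => ⨆ θ ∈ A, ⨆ h ∈ M.nuisanceBall k r,
      ‖M.m z θ (h (M.X z))‖ₑ) < ∞) :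
    ∃ b : 𝒵 → ℝ≥0∞, Measurable b ∧ ∫⁻ z, b z ∂M.P ≠ ∞ ∧
      ∀ h ∈ M.nuisanceBall k r, ∀ z, ‖M.momentField hm A z (h (M.X z))‖ₑ ≤ b z := by
  simp only [outerExpect, iInf_lt_iff] at hdom
  obtain ⟨b, hb, hle, hfin⟩ := hdom
  refine ⟨b, hb, hfin.ne, fun h hh z => enorm_continuousMap_le fun θ => ?_⟩
  exact (le_iSup₂_of_le (f := fun θ' (_ : θ' ∈ A) => ⨆ h ∈ M.nuisanceBall k r,
    ‖M.m z θ' (h (M.X z))‖ₑ) θ.1 θ.2 (le_iSup₂_of_le h hh le_rfl)).trans (hle z)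

lemma integrable_momentField {k : ℕ} {r : ℝ}
    (hdom : outerExpect M.P (fun z => ⨆ θ ∈ A, ⨆ h ∈ M.nuisanceBall k r,
      ‖M.m z θ (h (M.X z))‖ₑ) < ∞) :
    Integrable (fun z => M.momentField hm A z (M.h₀ (M.X z))) M.P := by
  obtain ⟨b, -, hfin, hle⟩ := exists_envelope (hm := hm) hdom
  refine ⟨(measurable_momentField_comp M.measurable_h₀).aestronglyMeasurable, ?_⟩
  exact (lintegral_mono fun z => hle _ (M.h₀_mem_nuisanceBall k r) z).trans_lt hfin.lt_top

/-- The moments depend on the nuisance function continuously, uniformly in the parameter and in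
mean over the data. -/
lemma exists_near_lintegral_le {k : ℕ} {r : ℝ}
    (hdom : outerExpect M.P (fun z => ⨆ θ ∈ A, ⨆ h ∈ M.nuisanceBall k r,
      ‖M.m z θ (h (M.X z))‖ₑ) < ∞) {ε : ℝ≥0∞} (hε : 0 < ε) :
    ∃ δ : ℝ≥0∞, 0 < δ ∧ ∀ h ∈ M.nuisanceNear k r δ,
      ∫⁻ z, ‖M.momentField hm A z (h (M.X z)) - M.momentField hm A z (M.h₀ (M.X z))‖ₑ ∂M.P
        ≤ ε := by
  obtain ⟨b, hb, hfin, hle⟩ := exists_envelope (hm := hm) hdom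
  by_contra! hno
  -- Summable radii make `∑ₙ |hₙ - h₀|²` integrable in each coordinate, so the counterexamples `hₙ`
  -- converge to `h₀` almost everywhere without passing to a subsequence. Dominated convergence with
  -- bound `2b` then contradicts `hbig`.
  obtain ⟨δ, hδ0, hδsum⟩ := ENNReal.exists_pos_sum_of_countable' one_ne_zero ℕ
  choose! h hnear hbig using fun n => hno (δ n) (hδ0 n)
  have hmeas : ∀ n, Measurable (h n) := fun n => M.measurable_H _ (hnear n).1.1
  have hcoord : ∀ i : Fin l, ∀ᵐ z ∂M.P,
      Tendsto (fun n => h n (M.X z) i) atTop (𝓝 (M.h₀ (M.X z) i)) := by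
    intro i
    have hX := M.measurable_X
    have hh₀ := M.measurable_h₀
    have hmi : ∀ n, Measurable fun z => ‖h n (M.X z) i - M.h₀ (M.X z) i‖ₑ ^ 2 := by
      intro n
      have hhn := hmeas n
      have h1 : Measurable fun z => h n (M.X z) i := by fun_prop
      have h2 : Measurable fun z => M.h₀ (M.X z) i := by fun_prop
      exact (h1.sub h2).enorm.pow_const _
    have hsum : ∫⁻ z, ∑' n, ‖h n (M.X z) i - M.h₀ (M.X z) i‖ₑ ^ 2 ∂M.P ≠ ∞ := by
      rw [lintegral_tsum fun n => (hmi n).aemeasurable]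
      refine ne_top_of_le_ne_top ENNReal.one_ne_top (le_trans ?_ hδsum.le)
      refine ENNReal.tsum_le_tsum fun n => ?_
      rw [← nuisanceError_two_single]
      exact (hnear n).2 i
    filter_upwards [ae_lt_top (.tsum hmi) hsum] with z hz
    have h0 := ENNReal.tendsto_atTop_zero_of_tsum_ne_top hz.ne
    rw [tendsto_iff_edist_tendsto_0]
    have h1 := (ENNReal.continuous_rpow_const (y := (1 / 2 : ℝ))).tendsto 0 |>.comp h0
    rw [ENNReal.zero_rpow_of_pos (by norm_num)] at h1
    refine h1.congr fun n => ?_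
    simp only [Function.comp_apply]
    rw [← ENNReal.rpow_natCast, ← ENNReal.rpow_mul, edist_eq_enorm_sub]
    norm_num
  have hlim : Tendsto (fun n => ∫⁻ z, ‖M.momentField hm A z (h n (M.X z)) -
      M.momentField hm A z (M.h₀ (M.X z))‖ₑ ∂M.P) atTop (𝓝 (∫⁻ _, 0 ∂M.P)) := by
    refine tendsto_lintegral_of_dominated_convergence (fun z => b z + b z)
      (fun n => ((measurable_momentField_comp (hmeas n)).sub
        (measurable_momentField_comp M.measurable_h₀)).enorm)
      (fun n => Eventually.of_forall fun z => enorm_sub_le.trans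
        (add_le_add (hle _ (hnear n).1 z) (hle _ (M.h₀_mem_nuisanceBall k r) z))) ?_ ?_
    · rw [lintegral_add_left hb]
      exact ENNReal.add_ne_top.mpr ⟨hfin, hfin⟩
    · filter_upwards [ae_all_iff.mpr hcoord] with z hz
      have hγ : Tendsto (fun n => h n (M.X z)) atTop (𝓝 (M.h₀ (M.X z))) := by
        have hpi := tendsto_pi_nhds.mpr hz
        exact ((PiLp.continuous_toLp 2 fun _ : Fin l => ℝ).tendsto _).comp hpi
      have := tendsto_iff_edist_tendsto_0.mp
        (((M.momentField hm A z).continuous.tendsto _).comp hγ)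
      simpa only [edist_eq_enorm_sub, Function.comp_apply] using this
  rw [lintegral_zero] at hlim
  obtain ⟨n, hn⟩ := (hlim.eventually (gt_mem_nhds hε)).exists
  exact absurd hn (not_lt.mpr (hbig n).le)

end MomentField

end Model

/-! ### Uniform law of large numbers with fresh first-stage estimates -/

namespace Model

variable {𝒵 𝒳 Ω : Type*} [MeasurableSpace 𝒵] [MeasurableSpace 𝒳] [MeasurableSpace Ω] {d l : ℕ}
  {M : Model 𝒵 𝒳 d l} {μ : Measure Ω}

/-- A random nuisance function fitted on data independent of `ζ`. -/
def IsFresh (M : Model 𝒵 𝒳 d l) (μ : Measure Ω) (ζ : Ω → 𝒵) (hhat : Ω → 𝒳 → Vec l) : Prop :=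
  ∃ (ι : Type) (g : (ι → 𝒵) → 𝒳 → Vec l) (D : Ω → ι → 𝒵), M.IsProcedure g ∧ Measurable D ∧
    IndepFun D ζ μ ∧ ∀ ω, hhat ω = g (D ω)

lemma IsSample.indepFun_tuple {Z : ℕ → Ω → 𝒵} (hZ : M.IsSample μ Z) {ι : Type} [Finite ι]
    (e : ι → ℕ) {t : ℕ} (ht : ∀ s, e s ≠ t) : IndepFun (fun ω s => Z (e s) ω) (Z t) μ := by
  have := Fintype.ofFinite ι
  have hdisj : Disjoint (Finset.univ.image e) {t} := by
    simp [ht]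
  have h := hZ.indep.indepFun_finset _ _ hdisj hZ.measurable
  have h1 : Measurable fun (w : (Finset.univ.image e) → 𝒵) (s : ι) =>
      w ⟨e s, Finset.mem_image_of_mem e (Finset.mem_univ s)⟩ :=
    measurable_pi_lambda _ fun _ => measurable_pi_apply _
  have h2 : Measurable fun w : ({t} : Finset ℕ) → 𝒵 => w ⟨t, Finset.mem_singleton_self t⟩ :=
    measurable_pi_apply _
  exact h.comp h1 h2

lemma IsSample.isFresh {Z : ℕ → Ω → 𝒵} (hZ : M.IsSample μ Z) {ι : Type} [Finite ι]
    (e : ι → ℕ) {t : ℕ} (ht : ∀ s, e s ≠ t) {g : (ι → 𝒵) → 𝒳 → Vec l} (hg : M.IsProcedure g) :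
    M.IsFresh μ (Z t) (fun ω => g fun s => Z (e s) ω) :=
  ⟨ι, g, fun ω s => Z (e s) ω, hg, measurable_pi_lambda _ fun s => hZ.measurable (e s),
    hZ.indepFun_tuple e ht, fun _ => rfl⟩

section MomentField

variable {hm : ∀ z, Continuous fun q : Vec d × Vec l => M.m z q.1 q.2} {A : Set (Vec d)}
  [CompactSpace A]

/-- A uniform law of large numbers over the compact parameter set `A`. -/
lemma IsSample.tendstoInMeasure_oracle [IsProbabilityMeasure μ] {Z : ℕ → Ω → 𝒵}
    (hZ : M.IsSample μ Z)
    (hint : Integrable (fun z => M.momentField hm A z (M.h₀ (M.X z))) M.P) :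
    TendstoInMeasure μ (fun (n : ℕ) ω => (n : ℝ)⁻¹ •
        ∑ t ∈ Finset.range n, M.momentField hm A (Z t ω) (M.h₀ (M.X (Z t ω)))) atTop
      (fun _ => ∫ z, M.momentField hm A z (M.h₀ (M.X z)) ∂M.P) := by
  set Φ : 𝒵 → C(A, Vec d) := fun z => M.momentField hm A z (M.h₀ (M.X z)) with hΦ
  have hΦm : Measurable Φ := measurable_momentField_comp M.measurable_h₀
  have hlaw : ∀ t, IdentDistrib (Z t) (Z 0) μ μ := fun t =>
    ⟨(hZ.measurable t).aemeasurable, (hZ.measurable 0).aemeasurable, by rw [hZ.law, hZ.law]⟩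
  have hint0 : Integrable (fun ω => Φ (Z 0 ω)) μ := by
    rw [← hZ.law 0] at hint
    exact hint.comp_measurable (hZ.measurable 0)
  have hmean : ∫ ω, Φ (Z 0 ω) ∂μ = ∫ z, Φ z ∂M.P := by
    rw [← hZ.law 0, integral_map (hZ.measurable 0).aemeasurable hΦm.aestronglyMeasurable]
  -- The strong law in `C(A, ℝᵈ)`: norm convergence there is uniformity over `A`.
  have hsl := strong_law_ae (fun t ω => Φ (Z t ω)) hint0
    (fun s t hst => (hZ.indep.indepFun hst).comp hΦm hΦm) (fun t => (hlaw t).comp hΦm)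
  rw [hmean] at hsl
  refine tendstoInMeasure_of_tendsto_ae (fun n => ?_) hsl
  exact ((Finset.measurable_fun_sum _ fun t _ =>
    hΦm.comp (hZ.measurable t)).aestronglyMeasurable.const_smul (n : ℝ)⁻¹)

/-- Once the fitting data are frozen, the estimate is a fixed function, and `hnear` bounds the
integral over the independent observation; integrating over the fitting data keeps the bound. -/
lemma IsFresh.aemeasurable_and_lintegral_le [IsProbabilityMeasure μ] {ζ : Ω → 𝒵}
    {hhat : Ω → 𝒳 → Vec l} (hfresh : M.IsFresh μ ζ hhat) (hζ : Measurable ζ)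
    (hlaw : μ.map ζ = M.P) {k : ℕ} {r : ℝ} {δ ε : ℝ≥0∞}
    (hnear : ∀ h ∈ M.nuisanceNear k r δ,
      ∫⁻ z, ‖M.momentField hm A z (h (M.X z)) - M.momentField hm A z (M.h₀ (M.X z))‖ₑ ∂M.P
        ≤ ε) :
    MeasurableSet {ω | hhat ω ∈ M.nuisanceNear k r δ} ∧
    AEMeasurable (fun ω => ‖M.momentField hm A (ζ ω) (hhat ω (M.X (ζ ω))) -
      M.momentField hm A (ζ ω) (M.h₀ (M.X (ζ ω)))‖ₑ) μ ∧
    ∫⁻ ω in {ω | hhat ω ∈ M.nuisanceNear k r δ},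
      ‖M.momentField hm A (ζ ω) (hhat ω (M.X (ζ ω))) -
        M.momentField hm A (ζ ω) (M.h₀ (M.X (ζ ω)))‖ₑ ∂μ ≤ ε := by
  obtain ⟨ι, g, D, hg, hD, hind, hhat_eq⟩ := hfresh
  obtain rfl : hhat = fun ω => g (D ω) := funext hhat_eq
  have hX := M.measurable_X
  obtain ⟨φ, hφ_eq⟩ : ∃ φ : (ι → 𝒵) × 𝒵 → ℝ≥0∞, ∀ w z, ‖M.momentField hm A z (g w (M.X z)) -
      M.momentField hm A z (M.h₀ (M.X z))‖ₑ = φ (w, z) :=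
    ⟨fun q => ‖M.momentField hm A q.2 (g q.1 (M.X q.2)) -
      M.momentField hm A q.2 (M.h₀ (M.X q.2))‖ₑ, fun _ _ => rfl⟩
  have hφ : Measurable φ := by
    have h1 : Measurable fun q : (ι → 𝒵) × 𝒵 => (q.2, g q.1 (M.X q.2)) :=
      measurable_snd.prodMk
        (hg.measurable.comp (measurable_fst.prodMk (hX.comp measurable_snd)))
    have h2 : Measurable fun q : (ι → 𝒵) × 𝒵 => (q.2, M.h₀ (M.X q.2)) :=
      measurable_snd.prodMk (M.measurable_h₀.comp (hX.comp measurable_snd))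
    have h3 := (measurable_momentField (hm := hm) (A := A)).comp h1
    have h4 := (measurable_momentField (hm := hm) (A := A)).comp h2
    have h5 : φ = _ := funext fun q => (hφ_eq q.1 q.2).symm
    rw [h5]
    exact (h3.sub h4).enorm
  simp only [hφ_eq]
  have hS : MeasurableSet {w | g w ∈ M.nuisanceNear k r δ} := hg.measurableSet_near k r δ
  refine ⟨hD hS, (hφ.comp (hD.prodMk hζ)).aemeasurable, ?_⟩
  refine setLIntegral_le_of_indepFun hD hζ hind hφ hS fun w hw => ?_
  rw [hlaw]
  have := hnear _ hw
  simpa only [hφ_eq] using this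

/-- Uniform convergence of the empirical moments with fresh first-stage estimates. -/
lemma IsSample.tendstoInMeasure_empirical [IsProbabilityMeasure μ] {Z : ℕ → Ω → 𝒵}
    (hZ : M.IsSample μ Z) {k : ℕ} {r : ℝ}
    (hdom : outerExpect M.P (fun z => ⨆ θ ∈ A, ⨆ h ∈ M.nuisanceBall k r,
      ‖M.m z θ (h (M.X z))‖ₑ) < ∞)
    {L : Filter ℕ} {N : ℕ → ℕ} (hN : Tendsto N L atTop) {hhat : ℕ → ℕ → Ω → 𝒳 → Vec l}
    (hfresh : ∀ᶠ n in L, ∀ t < N n, M.IsFresh μ (Z t) (hhat n t))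
    (hnear : ∀ δ : ℝ≥0∞, 0 < δ →
      Tendsto (fun n => μ {ω | ∃ t < N n, hhat n t ω ∉ M.nuisanceNear k r δ}) L (𝓝 0)) :
    TendstoInMeasure μ (fun n ω => (N n : ℝ)⁻¹ • ∑ t ∈ Finset.range (N n),
        M.momentField hm A (Z t ω) (hhat n t ω (M.X (Z t ω)))) L
      (fun _ => ∫ z, M.momentField hm A z (M.h₀ (M.X z)) ∂M.P) := by
  refine tendstoInMeasure_average_of_perturbation
    ((hZ.tendstoInMeasure_oracle (integrable_momentField hdom)).comp hN) fun ε hε => ?_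
  obtain ⟨δ, hδ, hδε⟩ := exists_near_lintegral_le (hm := hm) hdom hε
  refine ⟨_, hnear δ hδ, hfresh.mono fun n hn => ⟨?_, fun t ht => ?_⟩⟩
  · have : {ω | ∃ t < N n, hhat n t ω ∉ M.nuisanceNear k r δ} =
        ⋃ t, ⋃ _ : t < N n, {ω | hhat n t ω ∈ M.nuisanceNear k r δ}ᶜ := by
      ext ω
      simp
    rw [this]
    exact .iUnion fun t => .iUnion fun ht =>
      ((hn t ht).aemeasurable_and_lintegral_le (hZ.measurable t) (hZ.law t) hδε).1.compl
  · obtain ⟨-, h1, h2⟩ :=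
      (hn t ht).aemeasurable_and_lintegral_le (hZ.measurable t) (hZ.law t) hδε
    refine ⟨h1, (lintegral_mono_set fun ω hω => ?_).trans h2⟩
    by_contra hno
    exact hω ⟨t, ht, hno⟩

end MomentField

lemma integral_moment_eq_zero (M : Model 𝒵 𝒳 d l) : ∫ z, M.m z M.θ₀ (M.h₀ (M.X z)) ∂M.P = 0 := by
  have := M.isProb
  rw [← integral_condExp M.measurable_X.comap_le, integral_congr_ae M.moment_eq_zero]
  simp

/-- Consistency of the zeros of empirical moment maps whose first-stage estimates are fresh and
consistent. -/
theorem IsSample.consistent [IsProbabilityMeasure μ] {Z : ℕ → Ω → 𝒵} (hZ : M.IsSample μ Z)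
    {S : Finset (Fin l → ℕ)} (hM : M.MomentAssumptions S) {L : Filter ℕ} {N : ℕ → ℕ}
    (hN : Tendsto N L atTop) {hhat : ℕ → ℕ → Ω → 𝒳 → Vec l}
    (hfresh : ∀ᶠ n in L, ∀ t < N n, M.IsFresh μ (Z t) (hhat n t))
    (hnear : ∀ r : ℝ, 0 < r → ∀ δ : ℝ≥0∞, 0 < δ → Tendsto
      (fun n => μ {ω | ∃ t < N n, hhat n t ω ∉ M.nuisanceNear (maxOrder S) r δ}) L (𝓝 0))
    {F : ℕ → Ω → Vec d → Vec d}
    (hF : ∀ n ω θ, F n ω θ = (N n : ℝ)⁻¹ •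
      ∑ t ∈ Finset.range (N n), M.m (Z t ω) θ (hhat n t ω (M.X (Z t ω))))
    (hCC : M.CompactOrConvex μ L F) {θhat : ℕ → Ω → Vec d}
    (hθhat : ∀ᶠ n in L, ∀ᵐ ω ∂μ, θhat n ω ∈ M.Θ ∧ F n ω (θhat n ω) = 0) :
    TendstoInMeasure μ θhat L (fun _ => M.θ₀) := by
  have hm : ∀ z, Continuous fun q : Vec d × Vec l => M.m z q.1 q.2 := fun z =>
    (hM.smooth z).continuous
  obtain ⟨r, hr, hreg⟩ := hM.regular
  -- The population moment on `A` is the value of a `C(A, ℝᵈ)`-valued integral, which also yields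
  -- its continuity on `A`.
  have hpop : ∀ A ⊆ M.Θ, ∀ hA : IsCompact A, ∀ θ : A,
      haveI := isCompact_iff_compactSpace.mp hA
      (∫ z, M.momentField hm A z (M.h₀ (M.X z)) ∂M.P) θ =
        ∫ z, M.m z θ (M.h₀ (M.X z)) ∂M.P := by
    intro A hAΘ hA θ
    have := isCompact_iff_compactSpace.mp hA
    exact ContinuousMap.integral_apply
      (integrable_momentField (hm := hm) (hreg.moment_dominated A hAΘ hA)) θ
  refine M.tendstoInMeasure_of_uniform (G := fun θ => ∫ z, M.m z θ (M.h₀ (M.X z)) ∂M.P) hCC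
    ?_ ?_ M.integral_moment_eq_zero hM.identifiable hθhat
  · intro A hAΘ hA
    have := isCompact_iff_compactSpace.mp hA
    rw [continuousOn_iff_continuous_domRestrict]
    convert (∫ z, M.momentField hm A z (M.h₀ (M.X z)) ∂M.P).continuous using 1
    ext1 θ
    exact (hpop A hAΘ hA θ).symm
  · intro A hAΘ hA η hη
    have := isCompact_iff_compactSpace.mp hA
    have h := tendstoInMeasure_iff_norm.mp (hZ.tendstoInMeasure_empirical (hm := hm)
      (hreg.moment_dominated A hAΘ hA) hN hfresh (hnear r hr)) η hη
    refine tendsto_measure_zero_of_ae_subset h (Eventually.of_forall fun n =>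
      Eventually.of_forall fun ω hω => ?_)
    by_contra hlt
    simp only [Set.mem_ofPred_eq, not_le] at hlt
    refine hω fun θ hθ => lt_of_le_of_lt ?_ hlt
    have := ContinuousMap.norm_coe_le_norm ((N n : ℝ)⁻¹ • ∑ t ∈ Finset.range (N n),
      M.momentField hm A (Z t ω) (hhat n t ω (M.X (Z t ω))) -
        ∫ z, M.momentField hm A z (M.h₀ (M.X z)) ∂M.P) ⟨θ, hθ⟩
    rw [ContinuousMap.sub_apply, hpop A hAΘ hA] at this
    simpa [hF] using this

end Model

end OrthogonalML

/-! ### The two estimators -/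

open OrthogonalML OrthogonalML.Model
theorem theorem2 {𝒵 𝒳 Ω : Type*} [MeasurableSpace 𝒵] [MeasurableSpace 𝒳] [MeasurableSpace Ω]
    {d l : ℕ} (M : OrthogonalML.Model 𝒵 𝒳 d l) (S : Finset (Fin l → ℕ))
    (hM : M.MomentAssumptions S)
    (μ : Measure Ω) [IsProbabilityMeasure μ] (Z : ℕ → Ω → 𝒵) (hZ : M.IsSample μ Z) :
    -- sample splitting
    (∀ g : ∀ n : ℕ, (Fin n → 𝒵) → 𝒳 → Vec l,
      (∀ n, M.IsProcedure (g n)) →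
      M.FirstStageAssumptions S μ atTop (ssNuisance Z g) →
      M.CompactOrConvex μ atTop (M.ssMoment Z g) →
      ∀ θhat : ℕ → Ω → Vec d,
        (∀ n, 0 < n → ∀ᵐ ω ∂μ, θhat n ω ∈ M.Θ ∧ M.ssMoment Z g n ω (θhat n ω) = 0) →
        TendstoInMeasure μ θhat atTop (fun _ => M.θ₀)) ∧
    -- cross-fitting
    (∀ K : ℕ, 0 < K → ∀ fold : ∀ n : ℕ, Fin (2 * n) → Fin K, IsFolding fold →
      ∀ g : ∀ (n : ℕ) (k : Fin K), ({t : Fin (2 * n) // fold n t ≠ k} → 𝒵) → 𝒳 → Vec l,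
      (∀ n k, K ∣ 2 * n → M.IsProcedure (g n k)) →
      (∀ k, M.FirstStageAssumptions S μ (cfFilter K) (cfNuisance Z fold g k)) →
      M.CompactOrConvex μ (cfFilter K) (M.cfMoment Z fold g) →
      ∀ θhat : ℕ → Ω → Vec d,
        (∀ n, 0 < n → K ∣ 2 * n →
          ∀ᵐ ω ∂μ, θhat n ω ∈ M.Θ ∧ M.cfMoment Z fold g n ω (θhat n ω) = 0) →
        TendstoInMeasure μ θhat (cfFilter K) (fun _ => M.θ₀)) := by
  constructor
  · intro g hg hfs hCC θhat hθhat
    refine hZ.consistent hM (N := id) tendsto_id (hhat := fun n _ => ssNuisance Z g n)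
      (Eventually.of_forall fun n t ht => hZ.isFresh (fun s : Fin n => n + s)
        (fun s => by simp only [id] at ht; omega) (hg n)) (fun r hr δ hδ => ?_)
      (fun n ω θ => ?_) hCC ((eventually_gt_atTop 0).mono hθhat)
    · refine tendsto_measure_zero_of_ae_subset
        (hfs.tendsto_near le_rfl (Eventually.of_forall fun n ω => (hg n).mem _) hr hδ)
        (Eventually.of_forall fun n => Eventually.of_forall ?_)
      rintro ω ⟨t, -, ht⟩
      exact ht
    · simp only [ssMoment, one_div, id, Finset.sum_range]
  · intro K hK fold _ g hg hfs hCC θhat hθhat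
    have hle : cfFilter K ≤ atTop := inf_le_left
    have hdvd : ∀ᶠ n in cfFilter K, K ∣ 2 * n := mem_inf_of_right (mem_principal_self _)
    refine hZ.consistent hM (N := fun n => 2 * n)
      ((tendsto_id.const_mul_atTop' two_pos).mono_left hle)
      -- Each observation gets the estimate of its own fold. The default `h₀` is never evaluated, as
      -- only indices `t < 2 * n` occur.
      (hhat := fun n t => if ht : t < 2 * n then cfNuisance Z fold g (fold n ⟨t, ht⟩) n
        else fun _ => M.h₀) ?_ (fun r hr δ hδ => ?_) (fun n ω θ => ?_) hCC ?_
    · filter_upwards [hdvd] with n hn t ht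
      simp only [ht, dite_true]
      refine hZ.isFresh (fun s : {s : Fin (2 * n) // fold n s ≠ fold n ⟨t, ht⟩} => (s.1 : ℕ))
        (fun s hs => s.2 ?_) (hg n _ hn)
      congr 1
      exact Fin.ext hs
    -- A union bound over the folds: their number `K` does not grow with `n`.
    · have hfin : Tendsto (fun n => ∑ k : Fin K,
          μ {ω | cfNuisance Z fold g k n ω ∉ M.nuisanceNear (maxOrder S) r δ}) (cfFilter K)
          (𝓝 0) := by
        rw [← Finset.sum_const_zero (ι := Fin K) (s := Finset.univ)]
        exact tendsto_finsetSum _ fun k _ =>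
          (hfs k).tendsto_near hle (hdvd.mono fun n hn ω => (hg n k hn).mem _) hr hδ
      refine tendsto_of_tendsto_of_tendsto_of_le_of_le tendsto_const_nhds hfin
        (fun _ => zero_le) fun n => (measure_mono ?_).trans
          (measure_biUnion_finset_le Finset.univ
            fun k => {ω | cfNuisance Z fold g k n ω ∉ M.nuisanceNear (maxOrder S) r δ})
      rintro ω ⟨t, ht, hno⟩
      simp only [ht, dite_true] at hno
      exact Set.mem_biUnion (Finset.mem_univ (fold n ⟨t, ht⟩)) hno
    · rw [Finset.sum_range]
      simp only [cfMoment, one_div, Fin.is_lt, dite_true, Fin.eta, Nat.cast_mul, Nat.cast_ofNat]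
      congr 1
      -- The sum over observations is regrouped by fold.
      rw [← Finset.sum_fiberwise Finset.univ (fold n)]
      refine Finset.sum_congr rfl fun k _ => Finset.sum_congr rfl fun t ht => ?_
      rw [(Finset.mem_filter.mp ht).2]
    · filter_upwards [hdvd, hle (eventually_gt_atTop 0)] with n hn h0
      exact hθhat n h0 hn
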